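/- Let $\mathbf F_q$ be a finite field, $A=\mathbf F_q[T]$, $K=\mathbf F_q(T)$, let $L$ be a finite extension of $\mathbf F_q$ with an $\mathbf F_q$-algebra homomorphism $\gamma:A\to L$, and let $P=\ker\gamma$. Let $L\{\tau\}$ be the ring of Ore polynomials, with $\tau\lambda=\lambda^q\tau$ for $\lambda\in L$. Let $\Phi:A\to L\{\tau\}$ be a Drinfeld $A$-module of rank $2$ over $L$, that is, an $\mathbf F_q$-algebra homomorphism such that $\Phi_a$ has constant term $\gamma(a)$ for all $a\in A$ and $\Phi_T=a_1+a_2\tau+a_3\tau^2$ with $a_3\neq0$. Assume that $\Phi$ is ordinary, i.e. $\Phi[P](\overline L)\neq 0$. Let $L^\Phi$ be $L$ with the $A$-module structure $a\cdot x=\Phi_a(x)$, and let $\mathrm{End}_L\Phi$ be the ring of all $f\in L\{\tau\}$ with $f\Phi_a=\Phi_a f$ for all $a\in A$. Let $F=\tau^{[L:\mathbf F_q]}$ be the Frobenius of $L$ and let $P_\Phi(X)=X^2-cX+N$ with $c,N\in A$ be its characteristic polynomial (so for every ideal $I$ of $A$ prime to $P$, $F$ acts on the free $A/I$-module $\Phi[I](\overline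 L)$ of rank $2$ with characteristic polynomial $P_\Phi \bmod I$). Put $\Delta=c^2-4N$. Let $\rho\neq A$ be an ideal of $A$, different from $P$, such that $\rho^2\mid P_\Phi(1)$ and $\rho\mid c-2$. Let $O(\Delta/\rho^2)$ be the $A$-order of the quadratic field $K(F)\subset K\otimes_A\mathrm{End}_L\Phi$ whose discriminant is the ideal $\Delta\rho^{-2}$ of $A$. If $O(\Delta/\rho^2)\subset\mathrm{End}_L\Phi$, then the $A$-module $L^\Phi$ is not cyclic. -/

import Mathlib

open Polynomial TensorProduct

noncomputable section

/-! ## The Ore polynomial ring `L{τ}` -/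

section Ore

variable (Fq L : Type*) [Field Fq] [Fintype Fq] [Field L] [Algebra Fq L]

/-- The `q`-power Frobenius `x ↦ x ^ q` of an `𝔽_q`-algebra `E`, as an additive endomorphism. -/
def qFrob (E : Type*) [CommRing E] [Algebra Fq E] : AddMonoid.End E :=
  (FiniteField.frobeniusAlgHom Fq E).toRingHom.toAddMonoidHom

theorem qFrob_pow_apply {E : Type*} [CommRing E] [Algebra Fq E] (n : ℕ) (x : E) :
    (qFrob Fq E ^ n) x = x ^ Fintype.card Fq ^ n := by
  induction n generalizing x with
  | zero => simp
  | succ n ih =>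
    rw [pow_succ]
    change (qFrob Fq E ^ n) (x ^ Fintype.card Fq) = _
    rw [ih]
    rw [← pow_mul, pow_succ']

/-- `n` acts on `L` by the `n`-th iterate of the `q`-power Frobenius, `x ↦ x ^ (q ^ n)`. -/
@[reducible] def frobAction : MulSemiringAction (Multiplicative ℕ) L where
  smul n x := x ^ Fintype.card Fq ^ n.toAdd
  one_smul x := by change x ^ Fintype.card Fq ^ 0 = x; simp
  mul_smul m n x := by
    change x ^ Fintype.card Fq ^ (m.toAdd + n.toAdd) =
      (x ^ Fintype.card Fq ^ n.toAdd) ^ Fintype.card Fq ^ m.toAdd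
    rw [← pow_mul, ← pow_add, add_comm]
  smul_zero n := by
    change (0 : L) ^ Fintype.card Fq ^ n.toAdd = 0
    rw [← qFrob_pow_apply, map_zero]
  smul_add n x y := by
    change (x + y) ^ Fintype.card Fq ^ n.toAdd =
      x ^ Fintype.card Fq ^ n.toAdd + y ^ Fintype.card Fq ^ n.toAdd
    simp only [← qFrob_pow_apply, map_add]
  smul_one n := by change (1 : L) ^ Fintype.card Fq ^ n.toAdd = 1; simp
  smul_mul n x y := by
    change (x * y) ^ Fintype.card Fq ^ n.toAdd =
      x ^ Fintype.card Fq ^ n.toAdd * y ^ Fintype.card Fq ^ n.toAdd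
    rw [mul_pow]

/-- The Ore polynomial ring `L{τ}`, in which `τ * λ = λ ^ q * τ` for `λ ∈ L`. -/
@[nolint unusedArguments]
def Ore (_Fq L : Type*) [Field L] : Type _ := SkewPolynomial L

instance : Ring (Ore Fq L) :=
  letI := frobAction Fq L
  inferInstanceAs (Ring (SkewMonoidAlgebra L (Multiplicative ℕ)))

variable {L}

/-- The element `a τ ^ n` of `L{τ}`. -/
def Ore.monomial (n : ℕ) (a : L) : Ore Fq L := SkewPolynomial.monomial n a

variable {Fq}

/-- The coefficient of `τ ^ n`. -/
def Ore.coeff (f : Ore Fq L) (n : ℕ) : L := SkewPolynomial.coeff (R := L) f n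

theorem Ore.monomial_mul_monomial (m n : ℕ) (a b : L) :
    Ore.monomial Fq m a * Ore.monomial Fq n b =
      Ore.monomial Fq (m + n) (a * b ^ Fintype.card Fq ^ m) :=
  letI := frobAction Fq L
  SkewMonoidAlgebra.single_mul_single (k := L) (G := Multiplicative ℕ)

variable (Fq)

/-- `L{τ}` acts on every commutative `L`-algebra `E`: the element `∑ aᵢ τ ^ i` sends `x` to
`∑ aᵢ x ^ (q ^ i)`. -/
def Ore.act (E : Type*) [CommRing E] [Algebra L E] [Algebra Fq E] :
    Ore Fq L →+* AddMonoid.End E :=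
  letI := frobAction Fq L
  SkewMonoidAlgebra.liftNCRingHom (k := L) (G := Multiplicative ℕ)
    (Module.toAddMonoidEnd L E) (powersHom _ (qFrob Fq E)) (by
      intro a n
      ext x
      change (a ^ Fintype.card Fq ^ n.toAdd) • (qFrob Fq E ^ n.toAdd) x =
        (qFrob Fq E ^ n.toAdd) (a • x)
      rw [qFrob_pow_apply, qFrob_pow_apply, _root_.smul_pow])

theorem Ore.act_monomial (E : Type*) [CommRing E] [Algebra L E] [Algebra Fq E] (n : ℕ) (a : L)
    (x : E) : Ore.act Fq E (Ore.monomial Fq n a) x = a • x ^ Fintype.card Fq ^ n := by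
  let _ := frobAction Fq L
  have h : Ore.act Fq E (Ore.monomial Fq n a) =
      Module.toAddMonoidEnd L E a * powersHom _ (qFrob Fq E) (Multiplicative.ofAdd n) :=
    SkewMonoidAlgebra.liftNC_single (k := L) (G := Multiplicative ℕ) _ _ _ _
  rw [h]
  change a • (qFrob Fq E ^ n) x = _
  rw [qFrob_pow_apply]

variable (L)

/-- The Frobenius of the finite field `L` as an element of `L{τ}`: `F = τ ^ n`, `n = [L : 𝔽_q]`. -/
def Ore.frob : Ore Fq L := Ore.monomial Fq (Module.finrank Fq L) 1

theorem Ore.frob_mul [Finite L] (f : Ore Fq L) : Ore.frob Fq L * f = f * Ore.frob Fq L := by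
  have key : ∀ (n : ℕ) (a : L),
      Ore.frob Fq L * Ore.monomial Fq n a = Ore.monomial Fq n a * Ore.frob Fq L := by
    intro n a
    have hc : a ^ Fintype.card Fq ^ Module.finrank Fq L = a := by
      have := Fintype.ofFinite L
      rw [← Module.card_eq_pow_finrank (K := Fq) (V := L), FiniteField.pow_card]
    rw [Ore.frob, Ore.monomial_mul_monomial, Ore.monomial_mul_monomial, hc]
    simp [add_comm]
  refine SkewPolynomial.induction (R := L)
    (motive := fun g : Ore Fq L => Ore.frob Fq L * g = g * Ore.frob Fq L) f ?_ ?_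
  · exact (mul_zero (Ore.frob Fq L)).trans (zero_mul (Ore.frob Fq L)).symm
  · intro n a g _ _ hg
    exact (mul_add (Ore.frob Fq L) (Ore.monomial Fq n a) g).trans
      ((congrArg₂ (· + ·) (key n a) hg).trans
        (add_mul (Ore.monomial Fq n a) g (Ore.frob Fq L)).symm)

end Ore

/-! ## Drinfeld modules of rank 2 over `A = 𝔽_q[T]` -/

/-- A Drinfeld `𝔽_q[T]`-module of rank 2 over the `A`-field `(L, γ)`: a homomorphism
`Φ : 𝔽_q[T] → L{τ}` of `𝔽_q`-algebras such that `Φ_a` has constant term `γ a` and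
`Φ_T = a₁ + a₂ τ + a₃ τ ^ 2` with `a₃ ≠ 0`. -/
structure DrinfeldModule {Fq L : Type*} [Field Fq] [Fintype Fq] [Field L] [Algebra Fq L]
    (γ : Fq[X] →ₐ[Fq] L) where
  toRingHom : Fq[X] →+* Ore Fq L
  map_C : ∀ a : Fq, toRingHom (C a) = Ore.monomial Fq 0 (algebraMap Fq L a)
  coeff_zero : ∀ a : Fq[X], (toRingHom a).coeff 0 = γ a
  coeff_two_ne_zero : (toRingHom X).coeff 2 ≠ 0
  coeff_eq_zero : ∀ i : ℕ, 2 < i → (toRingHom X).coeff i = 0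

namespace DrinfeldModule

variable {Fq L : Type*} [Field Fq] [Fintype Fq] [Field L] [Algebra Fq L]
  {γ : Fq[X] →ₐ[Fq] L} (Φ : DrinfeldModule γ)

/-- The underlying additive group of the `A`-module that `Φ` defines on a commutative
`L`-algebra `E`. For `E = L` this is `L^Φ`. -/
@[nolint unusedArguments]
def Points (_Φ : DrinfeldModule γ) (E : Type*) : Type _ := E

section Points

variable (E : Type*) [CommRing E] [Algebra L E] [Algebra Fq E]

instance : AddCommGroup (Φ.Points E) := inferInstanceAs (AddCommGroup E)

/-- `a • x = Φ_a(x)`. -/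
instance : Module Fq[X] (Φ.Points E) :=
  letI : Module (AddMonoid.End E) (Φ.Points E) := inferInstanceAs (Module (AddMonoid.End E) E)
  Module.compHom (Φ.Points E) ((Ore.act Fq E).comp Φ.toRingHom)

theorem smul_def (a : Fq[X]) (x : Φ.Points E) :
    a • x = (Ore.act Fq E (Φ.toRingHom a) : AddMonoid.End E) x := rfl

end Points

/-- The endomorphism ring `End_L Φ`: all `f ∈ L{τ}` with `f Φ_a = Φ_a f` for every `a ∈ A`. -/
def endRing : Subring (Ore Fq L) := Subring.centralizer (Set.range Φ.toRingHom)

/-- `End_L Φ` is an `A`-algebra through `Φ`. -/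
instance : Algebra Fq[X] Φ.endRing :=
  RingHom.toAlgebra'
    (Φ.toRingHom.codRestrict Φ.endRing (by
      intro a
      rw [endRing, Subring.mem_centralizer_iff]
      rintro _ ⟨b, rfl⟩
      rw [← map_mul, ← map_mul, mul_comm]))
    (by
      rintro a ⟨f, hf⟩
      apply Subtype.ext
      exact (Subring.mem_centralizer_iff.mp hf _ ⟨a, rfl⟩))

section Frobenius

variable [Finite L]

/-- The Frobenius `F` of `L` as an endomorphism of `Φ`. -/
def frob : Φ.endRing :=
  ⟨Ore.frob Fq L, Subring.mem_centralizer_iff.mpr fun g _ => (Ore.frob_mul Fq L g).symm⟩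

/-- The Frobenius as an `A`-linear map `x ↦ x ^ (q ^ n)` on the points of `Φ` in `E`. -/
def frobPoints (E : Type*) [CommRing E] [Algebra L E] [Algebra Fq E] :
    Φ.Points E →ₗ[Fq[X]] Φ.Points E where
  toFun x := (Ore.act Fq E (Ore.frob Fq L) : AddMonoid.End E) x
  map_add' x y := map_add (Ore.act Fq E (Ore.frob Fq L) : AddMonoid.End E) x y
  map_smul' a x := by
    have h := congrArg (Ore.act Fq E) (Ore.frob_mul Fq L (Φ.toRingHom a))
    rw [map_mul, map_mul] at h
    exact DFunLike.congr_fun h x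

/-- The `I`-division points `Φ[I]` of `Φ` in an algebraic closure of `L`, an `A/I`-module. -/
abbrev torsion (I : Ideal Fq[X]) : Submodule Fq[X] (Φ.Points (AlgebraicClosure L)) :=
  Submodule.torsionBySet Fq[X] (Φ.Points (AlgebraicClosure L)) I

/-- The action of the Frobenius on `Φ[I]`, as an `A/I`-linear map. -/
def frobTorsion (I : Ideal Fq[X]) : Φ.torsion I →ₗ[Fq[X] ⧸ I] Φ.torsion I :=
  LinearMap.extendScalarsOfSurjective (S := Fq[X] ⧸ I) (Ideal.Quotient.mk_surjective (I := I))
    ((Φ.frobPoints (AlgebraicClosure L)).restrict (p := Φ.torsion I) (q := Φ.torsion I) (by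
      intro x hx
      rw [Submodule.mem_torsionBySet_iff] at hx ⊢
      intro a
      rw [← map_smul, hx a, map_zero]))

/-- `Q` is the characteristic polynomial of the Frobenius of `Φ`, i.e. its characteristic
polynomial on the Tate modules of `Φ`: for every ideal `I` of `A` prime to the characteristic
`P = ker γ`, the Frobenius acts on the `A/I`-module `Φ[I]` (which is free of rank 2)
with characteristic polynomial `Q mod I`. -/
def IsFrobCharpoly (Q : Fq[X][X]) : Prop :=
  ∀ I : Ideal Fq[X], IsCoprime I (RingHom.ker γ) →
    ∀ b : Module.Basis (Fin 2) (Fq[X] ⧸ I) (Φ.torsion I),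
      (LinearMap.toMatrix b b (Φ.frobTorsion I)).charpoly = Q.map (Ideal.Quotient.mk I)

/-- `Φ` is ordinary: it has non-trivial `P`-division points, `P = ker γ`. -/
def IsOrdinary : Prop := Φ.torsion (RingHom.ker γ) ≠ ⊥

/-- The `K`-algebra `K ⊗_A End_L Φ`, where `K = 𝔽_q(T)`. -/
def EndK : Type _ := FractionRing Fq[X] ⊗[Fq[X]] Φ.endRing

instance : Ring Φ.EndK := inferInstanceAs (Ring (FractionRing Fq[X] ⊗[Fq[X]] Φ.endRing))

instance : Algebra (FractionRing Fq[X]) Φ.EndK :=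
  inferInstanceAs (Algebra (FractionRing Fq[X]) (FractionRing Fq[X] ⊗[Fq[X]] Φ.endRing))

instance : Algebra Fq[X] Φ.EndK :=
  inferInstanceAs (Algebra Fq[X] (FractionRing Fq[X] ⊗[Fq[X]] Φ.endRing))

instance : IsScalarTower Fq[X] (FractionRing Fq[X]) Φ.EndK :=
  inferInstanceAs (IsScalarTower Fq[X] (FractionRing Fq[X])
    (FractionRing Fq[X] ⊗[Fq[X]] Φ.endRing))

/-- The canonical map `End_L Φ → K ⊗_A End_L Φ`, `f ↦ 1 ⊗ f`. -/
def endToEndK : Φ.endRing →ₐ[Fq[X]] Φ.EndK :=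
  Algebra.TensorProduct.includeRight (R := Fq[X]) (A := FractionRing Fq[X]) (B := Φ.endRing)

/-- The field `K(F)`: the subalgebra generated by the Frobenius `F` in `K ⊗_A End_L Φ`. -/
def FrobField : Type _ := Algebra.adjoin (FractionRing Fq[X]) {Φ.endToEndK Φ.frob}

instance : CommRing Φ.FrobField :=
  inferInstanceAs (CommRing (Algebra.adjoin (FractionRing Fq[X]) {Φ.endToEndK Φ.frob}))

instance : Algebra (FractionRing Fq[X]) Φ.FrobField :=
  inferInstanceAs (Algebra (FractionRing Fq[X])
    (Algebra.adjoin (FractionRing Fq[X]) {Φ.endToEndK Φ.frob}))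

instance : Algebra Fq[X] Φ.FrobField :=
  inferInstanceAs (Algebra Fq[X] (Algebra.adjoin (FractionRing Fq[X]) {Φ.endToEndK Φ.frob}))

instance : IsScalarTower Fq[X] (FractionRing Fq[X]) Φ.FrobField :=
  inferInstanceAs (IsScalarTower Fq[X] (FractionRing Fq[X])
    (Algebra.adjoin (FractionRing Fq[X]) {Φ.endToEndK Φ.frob}))

/-- The inclusion `K(F) → K ⊗_A End_L Φ`. -/
def fieldToEndK : Φ.FrobField →ₐ[FractionRing Fq[X]] Φ.EndK :=
  (Algebra.adjoin (FractionRing Fq[X]) {Φ.endToEndK Φ.frob}).val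

/-- `O` is an `A`-order of `K(F)`: a subring containing `A` that is finitely generated as an
`A`-module and spans `K(F)` over `K`. -/
def IsOrder (O : Subalgebra Fq[X] Φ.FrobField) : Prop :=
  (Subalgebra.toSubmodule O).FG ∧
    Submodule.span (FractionRing Fq[X]) (O : Set Φ.FrobField) = ⊤

/-- The ideal `D` is the discriminant of the quadratic `A`-order `O`, i.e. it is generated by the
discriminant of the trace form of `O` in an `A`-basis of `O`. -/
def HasDiscr (O : Subalgebra Fq[X] Φ.FrobField) (D : Ideal Fq[X]) : Prop :=
  ∃ b : Module.Basis (Fin 2) Fq[X] O, D = Ideal.span {Algebra.discr Fq[X] b}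

/-- The inclusion `O ⊂ End_L Φ`, both viewed inside `K ⊗_A End_L Φ`. -/
def ContainedInEnd (O : Subalgebra Fq[X] Φ.FrobField) : Prop :=
  ∀ x ∈ O, ∃ f : Φ.endRing, Φ.endToEndK f = Φ.fieldToEndK x

end Frobenius

end DrinfeldModule

end

/-! Write `ρ = (r)`, `c - 2 = r u` and `1 - c + N = r ^ 2 v`. The element `w = (F - 1) / r` of
`K(F)` satisfies `w ^ 2 = u w - v`, and `u ^ 2 - 4 v = Δ / r ^ 2`. An order with this nonzero
discriminant must contain `w` (`Subalgebra.mem_of_associated_discr`), so `w` comes from an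
endomorphism `f`, and `F - 1 = f Φ_r` in `L{τ}`.

The constant term of `F - 1` is `-1`, hence `γ r ≠ 0`. For an irreducible factor `l` of `r`, all `q
^ (2 deg l)` points of `Φ[l]` are killed by `F - 1`, so they lie in `L`. A finite cyclic `A`-module
has at most `q ^ deg l` points killed by `l`, a contradiction.

Two facts must be supplied first. The characteristic polynomial is known only through torsion
points; `IsFrobCharpoly.frob_sq` lifts it to an identity in `L{τ}`, because a nonzero Ore polynomial
has only finitely many zeros. Then `IsOrdinary.discr_ne_zero` gives `Δ ≠ 0`: otherwise `F ^ 2` would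
vanish on `Φ[P]`. -/

open Polynomial TensorProduct

noncomputable section

/-! ### Ore polynomials as additive polynomials under composition -/

namespace Ore

variable {Fq L : Type*} [Field Fq] [Fintype Fq] [Field L] [Algebra Fq L]

theorem induction_monomial {motive : Ore Fq L → Prop} (f : Ore Fq L) (zero : motive 0)
    (add_monomial : ∀ n a g, motive g → motive (monomial Fq n a + g)) : motive f :=
  SkewPolynomial.induction (R := L) (motive := motive) f zero
    fun n a g _ _ hg => add_monomial n a g hg

omit [Field Fq] [Fintype Fq] [Algebra Fq L] in
theorem ext_coeff {f g : Ore Fq L} (h : ∀ n, f.coeff n = g.coeff n) : f = g :=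
  SkewPolynomial.ext_iff.mpr h

theorem coeff_add (f g : Ore Fq L) (n : ℕ) : (f + g).coeff n = f.coeff n + g.coeff n :=
  DFunLike.congr_fun (SkewMonoidAlgebra.coeff_add (k := L) (G := Multiplicative ℕ) f g) _

theorem coeff_zero (n : ℕ) : (0 : Ore Fq L).coeff n = 0 := rfl

omit [Field Fq] [Fintype Fq] [Algebra Fq L] in
theorem coeff_monomial (m n : ℕ) (a : L) :
    (monomial Fq m a).coeff n = if m = n then a else 0 :=
  SkewPolynomial.coeff_monomial (R := L)

theorem act_add_apply {E : Type*} [CommRing E] [Algebra L E] [Algebra Fq E] (f g : Ore Fq L)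
    (x : E) : act Fq E (f + g) x = act Fq E f x + act Fq E g x :=
  DFunLike.congr_fun (map_add (act Fq E) f g) x

theorem act_sub_apply {E : Type*} [CommRing E] [Algebra L E] [Algebra Fq E] (f g : Ore Fq L)
    (x : E) : act Fq E (f - g) x = act Fq E f x - act Fq E g x :=
  DFunLike.congr_fun (map_sub (act Fq E) f g) x

theorem act_mul_apply {E : Type*} [CommRing E] [Algebra L E] [Algebra Fq E] (f g : Ore Fq L)
    (x : E) : act Fq E (f * g) x = act Fq E f (act Fq E g x) :=
  DFunLike.congr_fun (map_mul (act Fq E) f g) x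

/-- Serves twice: it reduces evaluation at any point to evaluation at the generic point `X` of
`L[X]`, and it compares the points over `L` with those over its algebraic closure. -/
theorem act_naturality {E E' : Type*} [CommRing E] [Algebra L E] [Algebra Fq E] [CommRing E']
    [Algebra L E'] [Algebra Fq E'] (φ : E →ₐ[L] E') (f : Ore Fq L) (x : E) :
    act Fq E' f (φ x) = φ (act Fq E f x) := by
  induction f using induction_monomial with
  | zero => simp
  | add_monomial n a g hg =>
    rw [act_add_apply, act_add_apply, map_add, hg,
      act_monomial, act_monomial, map_smul, map_pow]

/-- The additive polynomial `∑ aᵢ X ^ (q ^ i)` attached to `∑ aᵢ τ ^ i`. -/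
def addPoly (f : Ore Fq L) : L[X] := act Fq L[X] f X

theorem aeval_addPoly {E : Type*} [CommRing E] [Algebra L E] [Algebra Fq E] (f : Ore Fq L)
    (x : E) : aeval x f.addPoly = act Fq E f x := by
  rw [addPoly, ← act_naturality, aeval_X]

theorem addPoly_add (f g : Ore Fq L) : (f + g).addPoly = f.addPoly + g.addPoly := by
  rw [addPoly, act_add_apply, addPoly, addPoly]

theorem addPoly_zero : (0 : Ore Fq L).addPoly = 0 := by
  simp [addPoly]

theorem addPoly_monomial (n : ℕ) (a : L) :
    (monomial Fq n a).addPoly = C a * X ^ Fintype.card Fq ^ n := by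
  rw [addPoly, act_monomial, smul_eq_C_mul]

theorem addPoly_mul (f g : Ore Fq L) : (f * g).addPoly = f.addPoly.comp g.addPoly := by
  rw [comp_eq_aeval, aeval_addPoly, addPoly, act_mul_apply, addPoly]

theorem coeff_addPoly (f : Ore Fq L) (n : ℕ) :
    f.addPoly.coeff (Fintype.card Fq ^ n) = f.coeff n := by
  induction f using induction_monomial with
  | zero => simp [addPoly_zero, coeff_zero]
  | add_monomial m a g hg =>
    rw [addPoly_add, Polynomial.coeff_add, hg, coeff_add, addPoly_monomial, coeff_monomial,
      coeff_C_mul_X_pow]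
    simp only [(Nat.pow_right_injective (Fintype.one_lt_card (α := Fq))).eq_iff, eq_comm]

theorem addPoly_eq_zero {f : Ore Fq L} : f.addPoly = 0 ↔ f = 0 := by
  refine ⟨fun h => ext_coeff fun n => ?_, fun h => h ▸ addPoly_zero⟩
  rw [← coeff_addPoly, h, coeff_zero, Polynomial.coeff_zero]

theorem mem_rootSet_addPoly {E : Type*} [CommRing E] [IsDomain E] [Algebra L E] [Algebra Fq E]
    {f : Ore Fq L} (hf : f ≠ 0) {x : E} : x ∈ f.addPoly.rootSet E ↔ act Fq E f x = 0 := by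
  rw [mem_rootSet_of_ne (addPoly_eq_zero.not.mpr hf), aeval_addPoly]

theorem addPoly_coeff_zero (f : Ore Fq L) : f.addPoly.coeff 0 = 0 := by
  rw [coeff_zero_eq_aeval_zero, aeval_addPoly, map_zero]

instance : NoZeroDivisors (Ore Fq L) where
  eq_zero_or_eq_zero_of_mul_eq_zero {f g} h := by
    rw [← addPoly_eq_zero, addPoly_mul, comp_eq_zero_iff, addPoly_coeff_zero, C_0,
      addPoly_eq_zero, addPoly_eq_zero] at h
    exact h.imp_right And.right

/-- Every exponent `q ^ i` with `i > 0` vanishes in `L`, so only the linear term survives.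
Separability and the multiplicativity of constant terms (by the chain rule) both follow. -/
theorem derivative_addPoly (f : Ore Fq L) : derivative f.addPoly = C (f.coeff 0) := by
  induction f using induction_monomial with
  | zero => simp [addPoly_zero, coeff_zero]
  | add_monomial m a g hg =>
    rw [addPoly_add, derivative_add, hg, coeff_add, C_add, addPoly_monomial, coeff_monomial]
    congr 1
    rcases m with _ | m
    · simp
    · have : ((Fintype.card Fq : ℕ) : L) = 0 := by
        rw [← map_natCast (algebraMap Fq L), FiniteField.cast_card_eq_zero, map_zero]
      simp [derivative_X_pow, this]

theorem separable_addPoly {f : Ore Fq L} (h : f.coeff 0 ≠ 0) : f.addPoly.Separable := by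
  rw [Polynomial.Separable, derivative_addPoly]
  exact ⟨0, C (f.coeff 0)⁻¹, by rw [zero_mul, zero_add, ← C_mul, inv_mul_cancel₀ h, C_1]⟩

theorem coeff_zero_mul (f g : Ore Fq L) : (f * g).coeff 0 = f.coeff 0 * g.coeff 0 := by
  have h := derivative_addPoly (f * g)
  rw [addPoly_mul, derivative_comp, derivative_addPoly, derivative_addPoly, C_comp, ← C_mul] at h
  rw [← C_injective h, mul_comm]

end Ore

/-! ### The degree of `Φ_a`, and torsion-freeness of the endomorphism ring -/

namespace DrinfeldModule

variable {Fq L : Type*} [Field Fq] [Fintype Fq] [Field L] [Algebra Fq L]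
  {γ : Fq[X] →ₐ[Fq] L} (Φ : DrinfeldModule γ)

theorem natDegree_addPoly_X : (Φ.toRingHom X).addPoly.natDegree = Fintype.card Fq ^ 2 := by
  have hX : Φ.toRingHom X = Ore.monomial Fq 0 ((Φ.toRingHom X).coeff 0) +
      (Ore.monomial Fq 1 ((Φ.toRingHom X).coeff 1) +
        Ore.monomial Fq 2 ((Φ.toRingHom X).coeff 2)) := by
    refine Ore.ext_coeff fun n => ?_
    simp only [Ore.coeff_add, Ore.coeff_monomial]
    rcases n with _ | _ | _ | n
    · simp
    · simp
    · simp
    · simp [Φ.coeff_eq_zero (n + 1 + 1 + 1) (by omega)]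
  have hq : 1 < Fintype.card Fq := Fintype.one_lt_card
  have h2 := natDegree_C_mul_X_pow (Fintype.card Fq ^ 2) _ Φ.coeff_two_ne_zero
  rw [hX, Ore.addPoly_add, Ore.addPoly_add, Ore.addPoly_monomial, Ore.addPoly_monomial,
    Ore.addPoly_monomial, natDegree_add_eq_right_of_natDegree_lt,
    natDegree_add_eq_right_of_natDegree_lt, h2]
  · exact (natDegree_C_mul_X_pow_le _ _).trans_lt (h2.symm ▸ Nat.pow_lt_pow_right hq one_lt_two)
  · rw [natDegree_add_eq_right_of_natDegree_lt, h2]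
    · exact (natDegree_C_mul_X_pow_le _ _).trans_lt (Nat.pow_lt_pow_right hq two_pos)
    · exact (natDegree_C_mul_X_pow_le _ _).trans_lt (h2.symm ▸ Nat.pow_lt_pow_right hq one_lt_two)

theorem addPoly_C (a : Fq) : (Φ.toRingHom (C a)).addPoly = C (algebraMap Fq L a) * X := by
  rw [Φ.map_C, Ore.addPoly_monomial, pow_zero, pow_one]

/-- Induction on the degree through `a = b X + const`: composing with `Φ_T` multiplies the degree by
`q ^ 2`, and the constant contributes degree at most 1. -/
theorem natDegree_addPoly {a : Fq[X]} (ha : a ≠ 0) :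
    (Φ.toRingHom a).addPoly.natDegree = Fintype.card Fq ^ (2 * a.natDegree) := by
  induction hd : a.natDegree generalizing a with
  | zero =>
    rw [natDegree_eq_zero] at hd
    obtain ⟨x, rfl⟩ := hd
    rw [addPoly_C, natDegree_C_mul_X, mul_zero, pow_zero]
    simpa using ha
  | succ d ih =>
    have hdiv : a.divX.natDegree = d := by rw [natDegree_divX_eq_natDegree_tsub_one, hd]; rfl
    have hb : a.divX ≠ 0 := by
      rw [Ne, divX_eq_zero_iff]
      intro h
      rw [h, natDegree_C] at hd
      omega
    have hcomp : (Φ.toRingHom (a.divX * X)).addPoly.natDegree =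
        Fintype.card Fq ^ (2 * (d + 1)) := by
      rw [map_mul, Ore.addPoly_mul, natDegree_comp, ih hb hdiv, natDegree_addPoly_X, ← pow_add]
      congr 1
    conv_lhs => rw [← divX_mul_X_add a, map_add, Ore.addPoly_add]
    rw [natDegree_add_eq_left_of_natDegree_lt, hcomp]
    rw [hcomp, addPoly_C]
    exact (natDegree_C_mul_le _ _).trans_lt
      (natDegree_X_le.trans_lt (Nat.one_lt_pow (by omega) Fintype.one_lt_card))

theorem toRingHom_ne_zero {a : Fq[X]} (ha : a ≠ 0) : Φ.toRingHom a ≠ 0 := by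
  intro h
  have := Φ.natDegree_addPoly ha
  rw [h, Ore.addPoly_zero, natDegree_zero] at this
  exact absurd this (pow_pos Fintype.card_pos _).ne

instance : Module.IsTorsionFree Fq[X] Φ.endRing :=
  .of_smul_eq_zero fun a f h => by
    rw [Algebra.smul_def, mul_eq_zero] at h
    refine h.imp_left fun h => ?_
    by_contra ha
    exact Φ.toRingHom_ne_zero ha (congrArg Subtype.val h)

/-- A torsion-free module over the principal ideal domain `A` is flat, so tensoring preserves the
injection `A → K`. -/
theorem endToEndK_injective [Finite L] : Function.Injective Φ.endToEndK :=
  Algebra.TensorProduct.includeRight_injective (IsFractionRing.injective _ _)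

end DrinfeldModule

/-! ### Irreducible polynomials and residue rings over a finite field -/

theorem Polynomial.exists_irreducible_lt_natDegree (k : Type*) [Field k] [Finite k] (d : ℕ) :
    ∃ f : k[X], Irreducible f ∧ d < f.natDegree := by
  let S : Set k[X] := {f | f ≠ 0 ∧ f.natDegree ≤ d}
  have hS : S.Finite := by
    have : Finite (degreeLT k (d + 1)) := Finite.of_equiv _ (degreeLTEquiv k (d + 1)).symm.toEquiv
    refine (Set.toFinite (degreeLT k (d + 1) : Set k[X])).subset fun f hf => ?_
    rw [SetLike.mem_coe, mem_degreeLT, ← natDegree_lt_iff_degree_lt hf.1]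
    exact Nat.lt_succ_of_le hf.2
  -- Euclid's argument applied to `g + 1`; the factor `X` makes it nonconstant even when the product
  -- is constant.
  let g : k[X] := X * ∏ f ∈ hS.toFinset, f
  have hg0 : ∏ f ∈ hS.toFinset, f ≠ 0 :=
    Finset.prod_ne_zero_iff.mpr fun f hf => (hS.mem_toFinset.mp hf).1
  have hg : 0 < (g + 1).natDegree := by
    rw [← C_1, natDegree_add_C, natDegree_X_mul hg0]
    omega
  obtain ⟨f, hf, hfg⟩ := exists_irreducible_of_natDegree_pos hg
  refine ⟨f, hf, ?_⟩
  by_contra h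
  have hfS : f ∈ hS.toFinset := hS.mem_toFinset.mpr ⟨hf.ne_zero, not_lt.mp h⟩
  exact hf.not_isUnit (isUnit_of_dvd_one
    ((dvd_add_right ((Finset.dvd_prod_of_mem _ hfS).mul_left X)).mp hfg))

theorem Polynomial.natCard_quotient_span {k : Type*} [Field k] {f : k[X]} (hf : f ≠ 0) :
    Nat.card (k[X] ⧸ Ideal.span {f}) = Nat.card k ^ f.natDegree := by
  have : Module.Finite k (k[X] ⧸ Ideal.span {f}) := (AdjoinRoot.powerBasis hf).finite
  rw [Module.natCard_eq_pow_finrank (K := k), finrank_quotient_span_eq_natDegree]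

/-! ### Torsion points and the quadratic relation of the Frobenius -/

namespace DrinfeldModule

variable {Fq L : Type*} [Field Fq] [Fintype Fq] [Field L] [Algebra Fq L]
  {γ : Fq[X] →ₐ[Fq] L} (Φ : DrinfeldModule γ)

theorem mem_torsion_span {a : Fq[X]} {x : Φ.Points (AlgebraicClosure L)} :
    x ∈ Φ.torsion (Ideal.span {a}) ↔ a • x = 0 := by
  rw [torsion, Submodule.torsionBySet_span_singleton_eq, Submodule.mem_torsionBy_iff]

theorem natCard_torsion {a : Fq[X]} (ha : γ a ≠ 0) :
    Nat.card (Φ.torsion (Ideal.span {a})) = Fintype.card Fq ^ (2 * a.natDegree) := by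
  have ha0 : a ≠ 0 := fun h => ha (h ▸ map_zero γ)
  have hsep : (Φ.toRingHom a).addPoly.Separable :=
    Ore.separable_addPoly ((Φ.coeff_zero a).symm ▸ ha)
  rw [← Φ.natDegree_addPoly ha0, ← card_rootSet_eq_natDegree (K := AlgebraicClosure L) hsep
    (IsAlgClosed.splits _), ← Nat.card_eq_fintype_card]
  refine Nat.card_congr (Equiv.subtypeEquivRight fun x => ?_)
  exact Φ.mem_torsion_span.trans
    (Ore.mem_rootSet_addPoly (E := AlgebraicClosure L) (Φ.toRingHom_ne_zero ha0)).symm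

/-- A count suffices: `q ^ (2 deg a)` vectors over a field with `q ^ deg a` elements. -/
theorem exists_basis_torsion {a : Fq[X]} (ha : Irreducible a) (hγ : γ a ≠ 0) :
    Nonempty (Module.Basis (Fin 2) (Fq[X] ⧸ Ideal.span {a}) (Φ.torsion (Ideal.span {a}))) := by
  have hmax : (Ideal.span {a}).IsMaximal := PrincipalIdealRing.isMaximal_of_irreducible ha
  let _ : Field (Fq[X] ⧸ Ideal.span {a}) := Ideal.Quotient.field _
  have hcard := Φ.natCard_torsion hγ
  have hfin : Finite (Φ.torsion (Ideal.span {a})) :=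
    Nat.finite_of_card_ne_zero (hcard ▸ (pow_pos Fintype.card_pos _).ne')
  have h := Module.natCard_eq_pow_finrank (K := Fq[X] ⧸ Ideal.span {a})
    (V := Φ.torsion (Ideal.span {a}))
  rw [hcard, natCard_quotient_span ha.ne_zero, ← pow_mul, Nat.card_eq_fintype_card,
    (Nat.pow_right_injective (Fintype.one_lt_card (α := Fq))).eq_iff, mul_comm,
    Nat.mul_left_cancel_iff ha.natDegree_pos] at h
  exact ⟨Module.finBasisOfFinrankEq _ _ h.symm⟩

theorem frobPoints_relation [Finite L] {Φ : DrinfeldModule γ} {c N : Fq[X]} {I : Ideal Fq[X]}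
    (b : Module.Basis (Fin 2) (Fq[X] ⧸ I) (Φ.torsion I))
    (hb : (LinearMap.toMatrix b b (Φ.frobTorsion I)).charpoly =
      (X ^ 2 - C c * X + C N : Fq[X][X]).map (Ideal.Quotient.mk I))
    {x : Φ.Points (AlgebraicClosure L)} (hx : x ∈ Φ.torsion I) :
    Φ.frobPoints _ (Φ.frobPoints _ x) - c • Φ.frobPoints _ x + N • x = 0 := by
  have : Module.Free (Fq[X] ⧸ I) (Φ.torsion I) := .of_basis b
  have : Module.Finite (Fq[X] ⧸ I) (Φ.torsion I) := .of_basis b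
  have h := LinearMap.aeval_self_charpoly (Φ.frobTorsion I)
  rw [← LinearMap.charpoly_toMatrix _ b, hb] at h
  simp only [Polynomial.map_add, Polynomial.map_sub, Polynomial.map_mul, Polynomial.map_pow,
    map_X, Polynomial.map_C, map_add, map_sub, map_mul, map_pow, aeval_X, aeval_C] at h
  have h1 := congrArg Subtype.val (LinearMap.congr_fun h ⟨x, hx⟩)
  rw [pow_two] at h1
  exact h1

/-- The Cayley–Hamilton relation `F ^ 2 - c F + N = 0` in `L{τ}`. -/
theorem IsFrobCharpoly.frob_sq [Finite L] {Φ : DrinfeldModule γ} {c N : Fq[X]}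
    (h : Φ.IsFrobCharpoly (X ^ 2 - C c * X + C N)) :
    Ore.frob Fq L ^ 2 - Φ.toRingHom c * Ore.frob Fq L + Φ.toRingHom N = 0 := by
  set g := Ore.frob Fq L ^ 2 - Φ.toRingHom c * Ore.frob Fq L + Φ.toRingHom N with hg
  by_contra hg0
  -- `A` is infinite and `L` is finite.
  have hker : RingHom.ker γ ≠ ⊥ := fun hbot => by
    have := Finite.of_injective γ ((RingHom.injective_iff_ker_eq_bot _).mpr hbot)
    exact not_finite Fq[X]
  obtain ⟨p, hp, hp0⟩ := Submodule.exists_mem_ne_zero_of_ne_bot hker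
  -- Degree above that of `p` makes `l` prime to `P`; degree above that of `g` gives `Φ[l]` more
  -- points than `g` can have zeros.
  obtain ⟨l, hl, hld⟩ := exists_irreducible_lt_natDegree Fq (max p.natDegree g.addPoly.natDegree)
  rw [max_lt_iff] at hld
  have hcop : IsCoprime (Ideal.span {l}) (RingHom.ker γ) := by
    have h1 : IsCoprime l p := hl.coprime_iff_not_dvd.mpr fun hdvd =>
      (natDegree_le_of_dvd hdvd hp0).not_gt hld.1
    obtain ⟨a, b, hab⟩ := h1
    rw [Ideal.isCoprime_iff_exists]
    exact ⟨a * l, Ideal.mem_span_singleton'.mpr ⟨a, rfl⟩, b * p, Ideal.mul_mem_left _ _ hp, hab⟩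
  have hγ : γ l ≠ 0 := fun hl0 => by
    rw [Ideal.isCoprime_iff_sup_eq, sup_eq_right.mpr] at hcop
    · exact RingHom.ker_ne_top γ hcop
    · rwa [Ideal.span_singleton_le_iff_mem]
  obtain ⟨b⟩ := Φ.exists_basis_torsion hl hγ
  have hb := h _ hcop b
  have hact : ∀ y : AlgebraicClosure L, Ore.act Fq _ g y =
      Ore.act Fq _ (Ore.frob Fq L) (Ore.act Fq _ (Ore.frob Fq L) y) -
        Ore.act Fq _ (Φ.toRingHom c) (Ore.act Fq _ (Ore.frob Fq L) y) +
          Ore.act Fq _ (Φ.toRingHom N) y := fun y => by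
    rw [hg, Ore.act_add_apply, Ore.act_sub_apply, pow_two, Ore.act_mul_apply, Ore.act_mul_apply]
  have hfin : (g.addPoly.rootSet (AlgebraicClosure L)).Finite := rootSet_finite _ _
  have hle : Nat.card (Φ.torsion (Ideal.span {l})) ≤
      (g.addPoly.rootSet (AlgebraicClosure L)).ncard := by
    rw [← Nat.card_coe_set_eq]
    have := hfin.to_subtype
    refine Nat.card_mono hfin fun x hx => ?_
    refine (Ore.mem_rootSet_addPoly (E := AlgebraicClosure L) hg0).mpr ?_
    exact (hact x).trans (frobPoints_relation b (h _ hcop b) hx)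
  rw [Φ.natCard_torsion hγ] at hle
  have h1 := Nat.lt_pow_self (n := 2 * l.natDegree) (Fintype.one_lt_card (α := Fq))
  have h2 : (g.addPoly.rootSet (AlgebraicClosure L)).ncard ≤ g.addPoly.natDegree := by
    classical
    rw [rootSet_def, Set.ncard_coe_finset]
    exact (Multiset.toFinset_card_le _).trans ((card_roots' _).trans natDegree_map_le)
  omega

end DrinfeldModule

/-! ### Discriminants of quadratic orders -/

namespace Subalgebra

variable {A K E ι : Type*} [CommRing A] [Field K] [Algebra A K] [CommRing E] [Algebra K E]
  [Algebra A E] [IsScalarTower A K E] {O : Subalgebra A E}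

theorem linearIndependent_coe_basis [IsFractionRing A K] (b : Module.Basis ι A O) :
    LinearIndependent K fun i => (b i : E) := by
  rw [← LinearIndependent.iff_fractionRing (R := A)]
  exact b.linearIndependent.map' O.val.toLinearMap (LinearMap.ker_eq_bot.mpr Subtype.val_injective)

/-- The discriminant of an order does not change under extension of scalars to the fraction
field. -/
theorem algebraMap_discr [Fintype ι] [DecidableEq ι] (b : Module.Basis ι A O)
    (B : Module.Basis ι K E) (hB : ∀ i, B i = b i) :
    algebraMap A K (Algebra.discr A b) = Algebra.discr K B := by
  have hrepr : ∀ (x : O) (i : ι), B.repr x i = algebraMap A K (b.repr x i) := by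
    intro x i
    have hx : (x : E) = ∑ j, algebraMap A K (b.repr x j) • B j := by
      conv_lhs => rw [← b.sum_repr x]
      simp only [hB, algebraMap_smul]
      exact map_sum O.val _ _
    conv_lhs => rw [hx]
    rw [B.repr_sum_self]
  have htrace : ∀ x : O, algebraMap A K (Algebra.trace A O x) = Algebra.trace K E x := by
    intro x
    rw [Algebra.trace_eq_matrix_trace b, Algebra.trace_eq_matrix_trace B, Matrix.trace,
      Matrix.trace, map_sum]
    refine Finset.sum_congr rfl fun i _ => ?_
    rw [Matrix.diag_apply, Matrix.diag_apply, Algebra.leftMulMatrix_eq_repr_mul,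
      Algebra.leftMulMatrix_eq_repr_mul, ← hrepr, hB]
    rfl
  rw [Algebra.discr_def, Algebra.discr_def, RingHom.map_det]
  congr 1
  ext i j
  rw [RingHom.mapMatrix_apply, Matrix.map_apply, Algebra.traceMatrix_apply,
    Algebra.traceMatrix_apply, Algebra.traceForm_apply, Algebra.traceForm_apply, htrace, hB, hB]
  rfl

end Subalgebra

/-- The trace matrix has entries `2`, `u`, `u` and `u ^ 2 - 2 v`; no division by 2 occurs, so
characteristic 2 is covered. -/
theorem Algebra.discr_one_self {K E : Type*} [Field K] [CommRing E] [Algebra K E]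
    (B : Module.Basis (Fin 2) K E) (w : E) (h0 : B 0 = 1) (h1 : B 1 = w) {u v : K}
    (hw : w ^ 2 = u • w - v • 1) : Algebra.discr K B = u ^ 2 - 4 * v := by
  have hmul : ∀ x y : K, Algebra.trace K E (x • 1 + y • w) = 2 * x + u * y := by
    intro x y
    have e0 : (x • 1 + y • w) * B 0 = x • B 0 + y • B 1 := by simp [h0, h1]
    have e1 : (x • 1 + y • w) * B 1 = (- (y * v)) • B 0 + (x + y * u) • B 1 := by
      rw [h0, h1, add_mul, smul_mul_assoc, smul_mul_assoc, one_mul, ← pow_two, hw]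
      module
    rw [Algebra.trace_eq_matrix_trace B, Matrix.trace_fin_two, Algebra.leftMulMatrix_eq_repr_mul,
      Algebra.leftMulMatrix_eq_repr_mul, e0, e1]
    simp
    ring
  have t1 := hmul 1 0
  have tw := hmul 0 1
  have tw2 := hmul (-v) u
  have e2 : (-v) • (1 : E) + u • w = w ^ 2 := by rw [hw]; module
  rw [e2] at tw2
  simp only [one_smul, zero_smul, add_zero, zero_add] at t1 tw
  rw [Algebra.discr_def, Matrix.det_fin_two]
  simp only [Algebra.traceMatrix_apply, Algebra.traceForm_apply, h0, h1, mul_one, one_mul]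
  rw [← pow_two w, t1, tw, tw2]
  ring

/-- An order of rank 2 whose discriminant generates the same nonzero ideal as the discriminant of
the integral element `w` contains `w`. -/
theorem Subalgebra.mem_of_associated_discr {A K E : Type*} [CommRing A] [IsDomain A]
    [IsIntegrallyClosed A] [Field K] [Algebra A K] [IsFractionRing A K] [CommRing E] [Algebra K E]
    [Algebra A E] [IsScalarTower A K E] {O : Subalgebra A E} (b : Module.Basis (Fin 2) A O)
    {w : E} (hspan : ⊤ ≤ Submodule.span K (Set.range ![1, w])) {u v : A}
    (hw : w ^ 2 = u • w - v • 1) (hne : u ^ 2 - 4 * v ≠ 0)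
    (hdiscr : Associated (Algebra.discr A b) (u ^ 2 - 4 * v)) : w ∈ O := by
  have hinj : Function.Injective (algebraMap A K) := IsFractionRing.injective A K
  have hOfin : Module.Finite A O := .of_basis b
  have hli := Subalgebra.linearIndependent_coe_basis (K := K) b
  have hfin : Module.Finite K E := .of_fg_top
    (top_le_iff.mp hspan ▸ Submodule.fg_span (Set.finite_range _))
  have hrank : Module.finrank K E = 2 := by
    refine le_antisymm ?_ (by simpa using hli.fintype_card_le_finrank)
    rw [← finrank_top, ← top_le_iff.mp hspan]
    exact (finrank_range_le_card _).trans (by simp)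
  have : Nonempty (Fin 2) := ⟨0⟩
  let B := basisOfLinearIndependentOfCardEqFinrank hli (by simp [hrank])
  have hB : ∀ i, B i = b i := fun i => by simp [B]
  let W := basisOfTopLeSpanOfCardEqFinrank ![1, w] hspan (by simp [hrank])
  have hW0 : W 0 = 1 := by simp [W]
  have hW1 : W 1 = w := by simp [W]
  have hwK : w ^ 2 = algebraMap A K u • w - algebraMap A K v • 1 := by
    rw [hw, algebraMap_smul, algebraMap_smul]
  let M : Matrix (Fin 2) (Fin 2) K := fun i j => W.repr (B i) j
  have hM : ∀ i, (b i : E) = M i 0 • 1 + M i 1 • w := fun i => by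
    rw [← hB, ← hW0, ← hW1, ← Fin.sum_univ_two (fun j => M i j • W j)]
    exact (W.sum_repr (B i)).symm
  have hdet : algebraMap A K (Algebra.discr A b) =
      M.det ^ 2 * algebraMap A K (u ^ 2 - 4 * v) := by
    have : (B : Fin 2 → E) = (M.map (algebraMap K E)).mulVec W := by
      ext i
      rw [hB, hM, Matrix.mulVec, dotProduct, Fin.sum_univ_two, hW0, hW1]
      simp [Algebra.smul_def]
    rw [Subalgebra.algebraMap_discr b B hB, this, Algebra.discr_of_matrix_mulVec,
      Algebra.discr_one_self W w hW0 hW1 hwK]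
    simp only [map_sub, map_pow, map_mul, map_ofNat]
  -- Cancelling the nonzero discriminant shows that `det M ^ 2` is a unit of `A`; integral
  -- closedness brings `det M` itself into `A`.
  obtain ⟨d, hd⟩ : ∃ d : Aˣ, algebraMap A K d = M.det := by
    obtain ⟨e, he⟩ := hdiscr.symm
    rw [← he, mul_comm, map_mul] at hdet
    have hsq := mul_right_cancel₀ ((map_ne_zero_iff _ hinj).mpr hne) hdet
    obtain ⟨d, hd⟩ := IsIntegrallyClosed.exists_algebraMap_eq_of_isIntegral_pow (R := A)
      (x := M.det) two_pos (hsq ▸ isIntegral_algebraMap)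
    rw [← hd, ← map_pow, hinj.eq_iff] at hsq
    have hu : IsUnit d := (isUnit_pow_iff two_ne_zero).mp (hsq ▸ e.isUnit)
    exact ⟨hu.unit, hd⟩
  have hwint : IsIntegral A w := by
    refine ⟨X ^ 2 - (C u * X - C v), ?_, ?_⟩
    · exact monic_X_pow_sub (by compute_degree!)
    · simp [hw, Algebra.smul_def]
  -- Since `1 ∈ O`, Cramer's rule applied to its coordinates expresses the `w`-column of `M` through
  -- `a0`, `a1` and `d`, so that column lies in `A`. The other column is then integral over `A`.
  obtain ⟨a0, a1, ha⟩ : ∃ a0 a1 : A, a0 • (b 0 : E) + a1 • (b 1 : E) = 1 := by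
    refine ⟨b.repr 1 0, b.repr 1 1, ?_⟩
    have := congrArg Subtype.val (b.sum_repr 1)
    rwa [Fin.sum_univ_two] at this
  have hcoord : algebraMap A K a0 * M 0 0 + algebraMap A K a1 * M 1 0 = 1 ∧
      algebraMap A K a0 * M 0 1 + algebraMap A K a1 * M 1 1 = 0 := by
    rw [hM, hM, ← algebraMap_smul K a0, ← algebraMap_smul K a1, ← hW0, ← hW1] at ha
    have h := congrArg W.repr ha
    simp only [map_add, map_smul, Module.Basis.repr_self] at h
    exact ⟨by simpa [Algebra.smul_def] using DFunLike.congr_fun h 0,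
      by simpa [Algebra.smul_def] using DFunLike.congr_fun h 1⟩
  rw [Matrix.det_fin_two] at hd
  have hM01 : M 0 1 = - algebraMap A K (a1 * d) := by
    rw [map_mul, hd]
    linear_combination M 0 0 * hcoord.2 - M 0 1 * hcoord.1
  have hM11 : M 1 1 = algebraMap A K (a0 * d) := by
    rw [map_mul, hd]
    linear_combination M 1 0 * hcoord.2 - M 1 1 * hcoord.1
  have : Nontrivial E := ⟨1, 0, fun h => W.ne_zero 0 (hW0.trans h)⟩
  have hint : ∀ (i : Fin 2) (a : A), M i 1 = algebraMap A K a →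
      ∃ p : A, M i 0 = algebraMap A K p := by
    intro i a hMa
    have hE : algebraMap K E (M i 0) = b i - a • w := by
      rw [hM, hMa, algebraMap_smul, add_sub_cancel_right, Algebra.algebraMap_eq_smul_one]
    have : IsIntegral A (M i 0) := by
      rw [← isIntegral_algebraMap_iff (algebraMap K E).injective, hE]
      exact ((Algebra.IsIntegral.isIntegral (R := A) (b i)).map O.val).sub (hwint.smul a)
    obtain ⟨p, hp⟩ := IsIntegrallyClosed.isIntegral_iff.mp this
    exact ⟨p, hp.symm⟩
  obtain ⟨p, hp⟩ := hint 0 _ (hM01.trans (map_neg _ _).symm)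
  obtain ⟨s, hs⟩ := hint 1 _ hM11
  -- Eliminating `1` from the two basis expansions leaves `det M` times `w`.
  have hdw : (d : A) • w = p • (b 1 : E) - s • (b 0 : E) := by
    rw [hM, hM, ← algebraMap_smul K (d : A), ← algebraMap_smul K p, ← algebraMap_smul K s, hd, hp,
      hs]
    module
  have hmem : (d : A) • w ∈ O :=
    hdw ▸ O.sub_mem (O.smul_mem (b 1).2 p) (O.smul_mem (b 0).2 s)
  have := O.smul_mem hmem (↑d⁻¹ : A)
  rwa [smul_smul, Units.inv_mul, one_smul] at this

/-! ### Torsion in finite cyclic modules, and rationality over a finite field -/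

/-- On a finite module, the kernel and cokernel of multiplication by `a` have the same size, and the
cokernel of a cyclic module is a quotient of `R / a`. -/
theorem Submodule.natCard_torsionBy_le_of_isPrincipal {R M : Type*} [CommRing R] [AddCommGroup M]
    [Module R M] [Finite M] (hM : (⊤ : Submodule R M).IsPrincipal) (a : R)
    [Finite (R ⧸ Ideal.span {a})] :
    Nat.card (torsionBy R M a) ≤ Nat.card (R ⧸ Ideal.span {a}) := by
  obtain ⟨g, hg⟩ := hM
  let f : M →ₗ[R] M := DistribSMul.toLinearMap R M a
  let S := LinearMap.range f
  have hcard : Nat.card (torsionBy R M a) = Nat.card (M ⧸ S) := by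
    have h1 := Submodule.card_eq_card_quotient_mul_card (LinearMap.ker f)
    have h2 := Submodule.card_eq_card_quotient_mul_card S
    rw [Nat.card_congr f.quotKerEquivRange.toEquiv, h2, mul_comm] at h1
    exact (Nat.eq_of_mul_eq_mul_right Nat.card_pos h1).symm
  rw [hcard]
  let φ : (R ⧸ Ideal.span {a}) →ₗ[R] M ⧸ S :=
    Submodule.liftQ (Ideal.span {a}) (S.mkQ ∘ₗ LinearMap.toSpanSingleton R M g) (by
      rw [Ideal.span, span_le, Set.singleton_subset_iff]
      exact (Submodule.Quotient.mk_eq_zero S).mpr ⟨g, rfl⟩)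
  refine Nat.card_le_card_of_surjective φ fun y => ?_
  obtain ⟨m, rfl⟩ := S.mkQ_surjective y
  obtain ⟨s, rfl⟩ := mem_span_singleton.mp (hg ▸ mem_top : m ∈ span R {g})
  exact ⟨Ideal.Quotient.mk _ s, rfl⟩

theorem FiniteField.mem_range_algebraMap_of_pow_card_eq {L E : Type*} [Field L] [Finite L]
    [Field E] [Algebra L E] {x : E} (hx : x ^ Nat.card L = x) : x ∈ Set.range (algebraMap L E) := by
  have := Fintype.ofFinite L
  have h := prod_multiset_X_sub_C_of_monic_of_roots_card_eq
    (p := (X ^ Fintype.card L - X : L[X]))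
    (monic_X_pow_sub (by simpa using Fintype.one_lt_card (α := L)))
    (by rw [FiniteField.roots_X_pow_card_sub_X,
      FiniteField.X_pow_card_sub_X_natDegree_eq L Fintype.one_lt_card, Finset.card_val,
      Finset.card_univ])
  have hx0 := congrArg (aeval x) h
  rw [FiniteField.roots_X_pow_card_sub_X, map_sub, map_pow, aeval_X, ← Nat.card_eq_fintype_card,
    hx, sub_self, map_multiset_prod, Multiset.prod_eq_zero_iff, Multiset.mem_map] at hx0
  obtain ⟨p, hp, hp0⟩ := hx0
  obtain ⟨a, -, rfl⟩ := Multiset.mem_map.mp hp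
  rw [map_sub, aeval_X, aeval_C, sub_eq_zero] at hp0
  exact ⟨a, hp0.symm⟩

/-! ### The discriminant of an ordinary module, and the field `K(F)` -/

namespace DrinfeldModule

variable {Fq L : Type*} [Field Fq] [Fintype Fq] [Field L] [Finite L] [Algebra Fq L]
  {γ : Fq[X] →ₐ[Fq] L} {Φ : DrinfeldModule γ}

omit [Fintype Fq] in
theorem coeff_zero_frob : (Ore.frob Fq L).coeff 0 = 0 := by
  rw [Ore.frob, Ore.coeff_monomial, if_neg Module.finrank_pos.ne']

theorem act_frob (x : AlgebraicClosure L) :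
    Ore.act Fq (AlgebraicClosure L) (Ore.frob Fq L) x = x ^ Nat.card L := by
  rw [Ore.frob, Ore.act_monomial, one_smul, Module.natCard_eq_pow_finrank (K := Fq),
    Nat.card_eq_fintype_card]

/-- Constant terms in the relation give `N ∈ P`, and `c ^ 2 = 4 N` then forces `c ∈ P`. So `F ^ 2`
kills `Φ[P]`, but `F` is injective on points. -/
theorem IsOrdinary.discr_ne_zero (hord : Φ.IsOrdinary) {c N : Fq[X]}
    (hrel : Ore.frob Fq L ^ 2 - Φ.toRingHom c * Ore.frob Fq L + Φ.toRingHom N = 0) :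
    c ^ 2 - 4 * N ≠ 0 := by
  intro hD
  have hN : γ N = 0 := by
    have h : Ore.frob Fq L * Ore.frob Fq L + Φ.toRingHom N = Φ.toRingHom c * Ore.frob Fq L := by
      rw [← sub_eq_zero, ← hrel, pow_two]
      abel
    have h0 := congrArg (fun f => Ore.coeff f 0) h
    simpa only [Ore.coeff_add, Ore.coeff_zero_mul, coeff_zero_frob, mul_zero, zero_add,
      Φ.coeff_zero] using h0
  have hc : γ c = 0 := by
    rw [← pow_eq_zero_iff two_ne_zero, ← map_pow, sub_eq_zero.mp hD, map_mul, hN, mul_zero]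
  refine hord (eq_bot_iff.mpr fun x hx => ?_)
  rw [Submodule.mem_torsionBySet_iff] at hx
  have hFc : c • Φ.frobPoints _ x = 0 := by rw [← map_smul, hx ⟨c, hc⟩, map_zero]
  have hNx : N • x = 0 := hx ⟨N, hN⟩
  have hact := DFunLike.congr_fun (congrArg (Ore.act Fq (AlgebraicClosure L)) hrel)
    (show AlgebraicClosure L from x)
  rw [Ore.act_add_apply, Ore.act_sub_apply, pow_two, Ore.act_mul_apply, Ore.act_mul_apply] at hact
  have h2 : Φ.frobPoints _ (Φ.frobPoints _ x) - c • Φ.frobPoints _ x + N • x = 0 := by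
    rw [map_zero] at hact
    exact hact
  rw [hFc, hNx, sub_zero, add_zero] at h2
  have h3 : ∀ y : Φ.Points (AlgebraicClosure L), Φ.frobPoints _ y = 0 → y = 0 := fun y hy =>
    (pow_eq_zero_iff (M₀ := AlgebraicClosure L) Nat.card_pos.ne').mp ((act_frob y).symm.trans hy)
  exact h3 x (h3 _ h2)

/-- The Frobenius as an element of `K(F)`. -/
def fieldFrob (Φ : DrinfeldModule γ) : Φ.FrobField :=
  ⟨Φ.endToEndK Φ.frob, Algebra.subset_adjoin rfl⟩

theorem fieldToEndK_injective : Function.Injective Φ.fieldToEndK := Subtype.val_injective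

theorem fieldToEndK_fieldFrob : Φ.fieldToEndK Φ.fieldFrob = Φ.endToEndK Φ.frob := rfl

theorem fieldToEndK_algebraMap (a : Fq[X]) :
    Φ.fieldToEndK (algebraMap Fq[X] Φ.FrobField a) = algebraMap Fq[X] Φ.EndK a := rfl

theorem fieldFrob_relation {c N : Fq[X]}
    (hrel : Ore.frob Fq L ^ 2 - Φ.toRingHom c * Ore.frob Fq L + Φ.toRingHom N = 0) :
    Φ.fieldFrob ^ 2 - algebraMap _ _ c * Φ.fieldFrob + algebraMap _ _ N = 0 := by
  apply fieldToEndK_injective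
  have h : Φ.frob ^ 2 - algebraMap _ _ c * Φ.frob + algebraMap _ _ N = 0 := Subtype.ext hrel
  have h' := congrArg Φ.endToEndK h
  rw [map_add, map_sub, map_pow, map_mul, AlgHom.commutes, AlgHom.commutes, map_zero] at h'
  rw [map_add, map_sub, map_pow, map_mul, fieldToEndK_algebraMap, fieldToEndK_algebraMap,
    fieldToEndK_fieldFrob, map_zero, h']

/-- Every element is a polynomial in `F`; take the remainder modulo the monic quadratic that `F`
satisfies. -/
theorem exists_eq_smul_one_add_smul_fieldFrob {c N : Fq[X]}
    (hrel : Φ.fieldFrob ^ 2 - algebraMap _ _ c * Φ.fieldFrob + algebraMap _ _ N = 0)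
    (x : Φ.FrobField) : ∃ s t : FractionRing Fq[X], x = s • 1 + t • Φ.fieldFrob := by
  let q : (FractionRing Fq[X])[X] := X ^ 2 - (C (algebraMap _ _ c) * X - C (algebraMap _ _ N))
  have hdeg : (C (algebraMap _ (FractionRing Fq[X]) c) * X - C (algebraMap _ _ N)).degree <
      ((2 : ℕ) : WithBot ℕ) := by compute_degree!
  have hq : q.Monic := monic_X_pow_sub hdeg
  have hq2 : q.natDegree = 2 := by
    simp only [q]
    compute_degree!
  have hq0 : aeval Φ.fieldFrob q = 0 := by
    rw [← hrel]
    simp only [q, map_sub, map_pow, map_mul, aeval_X, aeval_C,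
      ← IsScalarTower.algebraMap_apply]
    ring
  have hx : Φ.fieldToEndK x ∈
      Algebra.adjoin (FractionRing Fq[X]) {Φ.endToEndK Φ.frob} := x.2
  rw [Algebra.adjoin_singleton_eq_range_aeval] at hx
  obtain ⟨p, hp⟩ := hx
  have hpx : x = aeval Φ.fieldFrob p := by
    apply fieldToEndK_injective
    rw [← aeval_algHom_apply]
    exact hp.symm
  obtain ⟨t, s, hts⟩ := exists_eq_X_add_C_of_natDegree_le_one (p := p %ₘ q) (by
    have := natDegree_modByMonic_lt p hq (fun h => by simp [h] at hq2)
    omega)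
  refine ⟨s, t, ?_⟩
  rw [hpx, ← modByMonic_add_div p q, map_add, map_mul, hq0, zero_mul, add_zero, hts]
  simp [Algebra.smul_def, add_comm]

end DrinfeldModule

/-! ### Dividing `F - 1` by `r`, and rational torsion -/

namespace DrinfeldModule

variable {Fq L : Type*} [Field Fq] [Fintype Fq] [Field L] [Finite L] [Algebra Fq L]
  {γ : Fq[X] →ₐ[Fq] L} {Φ : DrinfeldModule γ}

/-- If the order `O` has discriminant `(c ^ 2 - 4 N) / r ^ 2 ≠ 0` and `r` satisfies the
congruences `r ∣ c - 2`, `r ^ 2 ∣ 1 - c + N`, then `O` contains `(F - 1) / r`. -/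
theorem exists_mem_order_mul_eq_frob_sub_one {c N r u v : Fq[X]}
    (hrel : Φ.fieldFrob ^ 2 - algebraMap _ _ c * Φ.fieldFrob + algebraMap _ _ N = 0)
    (hr : r ≠ 0) (hu : c - 2 = r * u) (hv : 1 - c + N = r ^ 2 * v)
    {O : Subalgebra Fq[X] Φ.FrobField} (b : Module.Basis (Fin 2) Fq[X] O)
    (hne : u ^ 2 - 4 * v ≠ 0) (hdiscr : Associated (Algebra.discr Fq[X] b) (u ^ 2 - 4 * v)) :
    ∃ w ∈ O, algebraMap _ _ r * w = Φ.fieldFrob - 1 := by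
  have hrK : algebraMap Fq[X] (FractionRing Fq[X]) r ≠ 0 :=
    (map_ne_zero_iff _ (IsFractionRing.injective _ _)).mpr hr
  have hrU : IsUnit (algebraMap Fq[X] Φ.FrobField r) := by
    rw [IsScalarTower.algebraMap_apply Fq[X] (FractionRing Fq[X]) Φ.FrobField]
    exact hrK.isUnit.map _
  let w : Φ.FrobField := ((hrU.unit⁻¹ : (Φ.FrobField)ˣ) : Φ.FrobField) * (Φ.fieldFrob - 1)
  have hrw : algebraMap _ _ r * w = Φ.fieldFrob - 1 := by
    rw [← mul_assoc, hrU.mul_val_inv, one_mul]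
  refine ⟨w, ?_, hrw⟩
  have hw : w ^ 2 = u • w - v • 1 := by
    have hu' := congrArg (algebraMap Fq[X] Φ.FrobField) hu
    have hv' := congrArg (algebraMap Fq[X] Φ.FrobField) hv
    simp only [map_sub, map_add, map_mul, map_pow, map_one, map_ofNat] at hu' hv'
    -- After multiplication by `r ^ 2` the claim reads `(F - 1) ^ 2 = (c - 2) (F - 1) - (1 - c +
    -- N)`, the relation of `F` rewritten in `F - 1`.
    apply (hrU.pow 2).mul_left_cancel
    rw [Algebra.smul_def, Algebra.smul_def]
    linear_combination (algebraMap _ _ r * w + Φ.fieldFrob - 1 - algebraMap _ _ r *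
      algebraMap _ _ u) * hrw + (Φ.fieldFrob - 1) * hu' - hv' + hrel
  refine Subalgebra.mem_of_associated_discr b (K := FractionRing Fq[X]) (fun x _ => ?_) hw hne
    hdiscr
  obtain ⟨s, t, rfl⟩ := exists_eq_smul_one_add_smul_fieldFrob hrel x
  rw [Matrix.range_cons, Matrix.range_cons, Matrix.range_empty, Set.union_empty,
    Set.singleton_union, Submodule.mem_span_pair]
  refine ⟨s + t, t * algebraMap _ _ r, ?_⟩
  rw [mul_smul, algebraMap_smul, Algebra.smul_def r w, hrw, add_smul, smul_sub, add_add_sub_cancel]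

/-- If `F - 1` is a multiple of `Φ_l`, the `l`-division points are rational over `L`. -/
theorem natCard_torsion_le {l : Fq[X]} {f : Ore Fq L}
    (hf : f * Φ.toRingHom l = Ore.frob Fq L - 1) :
    Nat.card (Φ.torsion (Ideal.span {l})) ≤
      Nat.card (Submodule.torsionBy Fq[X] (Φ.Points L) l) := by
  have hfix : ∀ x : AlgebraicClosure L, Ore.act Fq _ (Φ.toRingHom l) x = 0 →
      x ∈ Set.range (algebraMap L (AlgebraicClosure L)) := by
    intro x hx
    apply FiniteField.mem_range_algebraMap_of_pow_card_eq
    have h : Ore.act Fq _ (f * Φ.toRingHom l) x = 0 := by rw [Ore.act_mul_apply, hx, map_zero]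
    rw [hf, Ore.act_sub_apply, act_frob, map_one, sub_eq_zero] at h
    exact h
  have hmap : ∀ y : L, Ore.act Fq (AlgebraicClosure L) (Φ.toRingHom l) (algebraMap L _ y) =
      algebraMap L _ (Ore.act Fq L (Φ.toRingHom l) y) := fun y =>
    Ore.act_naturality (Algebra.ofId L (AlgebraicClosure L)) _ y
  have : Finite (Φ.Points L) := inferInstanceAs (Finite L)
  refine Nat.card_le_card_of_surjective (fun y => ⟨algebraMap L (AlgebraicClosure L) y.1,
    Φ.mem_torsion_span.mpr ?_⟩) fun x => ?_
  · exact (hmap y.1).trans ((congrArg _ y.2).trans (map_zero _))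
  · obtain ⟨y, hy⟩ := hfix x.1 (Φ.mem_torsion_span.mp x.2)
    refine ⟨⟨y, ?_⟩, Subtype.ext hy⟩
    apply (algebraMap L (AlgebraicClosure L)).injective
    refine ((hmap y).symm.trans ?_).trans (map_zero (algebraMap L (AlgebraicClosure L))).symm
    rw [hy]
    exact Φ.mem_torsion_span.mp x.2

end DrinfeldModule

end

/-! ### Non-cyclicity of the rational points -/

theorem corollary2p1 {Fq L : Type*} [Field Fq] [Fintype Fq] [Field L] [Finite L] [Algebra Fq L]
    (γ : Fq[X] →ₐ[Fq] L) (Φ : DrinfeldModule γ) (hord : Φ.IsOrdinary)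
    (c N : Fq[X]) (hchar : Φ.IsFrobCharpoly (X ^ 2 - C c * X + C N))
    (ρ : Ideal Fq[X]) (hρ : ρ ≠ ⊤) (hρP : ρ ≠ RingHom.ker γ)
    (hρ1 : (X ^ 2 - C c * X + C N : Fq[X][X]).eval 1 ∈ ρ ^ 2) (hρ2 : c - 2 ∈ ρ)
    (O : Subalgebra Fq[X] Φ.FrobField) (hO : Φ.IsOrder O)
    (D : Ideal Fq[X]) (hD : Φ.HasDiscr O D) (hDρ : D * ρ ^ 2 = Ideal.span {c ^ 2 - 4 * N})
    (hEnd : Φ.ContainedInEnd O) :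
    ¬ (⊤ : Submodule Fq[X] (Φ.Points L)).IsPrincipal := by
  intro hcyc
  have hrel := hchar.frob_sq
  have hΔ := hord.discr_ne_zero hrel
  obtain ⟨r, rfl⟩ := (IsPrincipalIdealRing.principal ρ).principal
  change c - 2 ∈ Ideal.span {r} at hρ2
  change _ ∈ Ideal.span {r} ^ 2 at hρ1
  change D * Ideal.span {r} ^ 2 = _ at hDρ
  change Ideal.span {r} ≠ ⊤ at hρ
  rw [Ideal.span_singleton_pow, Ideal.mem_span_singleton] at hρ1
  obtain ⟨v, hv⟩ := hρ1
  obtain ⟨u, hu⟩ := Ideal.mem_span_singleton.mp hρ2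
  have hv : 1 - c + N = r ^ 2 * v := by simpa using hv
  have huv : c ^ 2 - 4 * N = (u ^ 2 - 4 * v) * r ^ 2 := by
    linear_combination (c - 2 + r * u) * hu - 4 * hv
  have hr : r ≠ 0 := by
    rintro rfl
    exact hΔ (by rw [huv, zero_pow two_ne_zero, mul_zero])
  obtain ⟨b, rfl⟩ := hD
  rw [Ideal.span_singleton_pow, Ideal.span_singleton_mul_span_singleton,
    Ideal.span_singleton_eq_span_singleton, huv] at hDρ
  have hdiscr := hDρ.of_mul_right (Associated.refl _) (pow_ne_zero 2 hr)
  obtain ⟨w, hwO, hw⟩ := DrinfeldModule.exists_mem_order_mul_eq_frob_sub_one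
    (DrinfeldModule.fieldFrob_relation hrel) hr hu hv b (left_ne_zero_of_mul (huv ▸ hΔ)) hdiscr
  obtain ⟨f, hf⟩ := hEnd w hwO
  have hfr : f * algebraMap _ _ r = Φ.frob - 1 := by
    apply Φ.endToEndK_injective
    rw [← Algebra.commutes, map_mul, AlgHom.commutes, hf, map_sub, map_one,
      ← DrinfeldModule.fieldToEndK_fieldFrob, ← map_one Φ.fieldToEndK, ← map_sub, ← hw, map_mul,
      DrinfeldModule.fieldToEndK_algebraMap]
  have hfr' : (f : Ore Fq L) * Φ.toRingHom r = Ore.frob Fq L - 1 := congrArg Subtype.val hfr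
  -- Comparing constant terms in `F = f Φ_r + 1`: if `γ r = 0`, the left side has 0 and the right
  -- side 1.
  have hγr : γ r ≠ 0 := by
    intro h0
    have h := congrArg (fun g => Ore.coeff g 0) (sub_eq_iff_eq_add.mp hfr'.symm)
    simp only [Ore.coeff_add, Ore.coeff_zero_mul, Φ.coeff_zero, h0, mul_zero, zero_add,
      DrinfeldModule.coeff_zero_frob] at h
    exact zero_ne_one (h.trans (SkewPolynomial.coeff_one_zero (R := L)))
  obtain ⟨l, hl, s, rfl⟩ := WfDvdMonoid.exists_irreducible_factor
    (mt Ideal.span_singleton_eq_top.mpr hρ) hr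
  rw [map_mul] at hγr
  have hγl := left_ne_zero_of_mul hγr
  -- With `r = l s`, the cofactor `Φ_s` is absorbed into the endomorphism: `F - 1 = (f Φ_s) Φ_l`.
  rw [mul_comm, map_mul, ← mul_assoc] at hfr'
  have hle := DrinfeldModule.natCard_torsion_le hfr'
  have hquot := natCard_quotient_span hl.ne_zero
  rw [Nat.card_eq_fintype_card (α := Fq)] at hquot
  have : Finite (Fq[X] ⧸ Ideal.span {l}) :=
    Nat.finite_of_card_ne_zero (hquot.trans_ne (pow_pos Fintype.card_pos _).ne')
  have : Finite (Φ.Points L) := inferInstanceAs (Finite L)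
  have hlt := hle.trans (Submodule.natCard_torsionBy_le_of_isPrincipal hcyc l)
  -- The counts reduce to `2 deg l ≤ deg l`, impossible as `deg l > 0`.
  rw [Φ.natCard_torsion hγl, hquot, Nat.pow_le_pow_iff_right Fintype.one_lt_card] at hlt
  have := hl.natDegree_pos
  omega
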